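/- All graphs are undirected, finite and loopless, and may have parallel edges; they are considered up to isomorphism. The degree $\deg_G(v)$ of a vertex $v$ is the number of edges incident to $v$, counted with multiplicity, and $E_G(v)$ is the set of these edges. For $r \ge 1$, $\theta_r$ is the graph with two vertices and $r$ parallel edges between them. *Immersions.* Lifting two non-parallel distinct edges $e = uv$ and $f = vw$ (so $u \ne w$) of a graph means removing $e$ and $f$ and adding a new edge $uw$. A graph $H$ is an immersion of $G$ if a graph isomorphic to $H$ can be obtained from some subgraph of $G$ by a series of liftings followed by the deletion of some isolated vertices. *Edge sums.* Let $G_1, G_2$ be graphs, let $v_i \in V(G_i)$ with $\deg_{G_1}(v_1) = \deg_{G_2}(v_2) = k'$, and let $\sigma : E_{G_1}(v_1) \to E_{G_2}(v_2)$ be a bijection. The $k'$-edge sum of $G_1$ and $G_2$ on $v_1, v_2$ with respect to $\sigma$ is obtained from the disjoint union of $G_1$ and $G_2$ by identifying $v_1$ with $v_2$, lifting each $e \in E_{G_1}(v_1)$ with $\sigma(e)$, and removing the identified vertex. A graph $G$ is a $(\le k)$-edge sum of $G_1$ and $G_2$ if it is their disjoint union or, for some $1 \le k' \le k$, a $k'$-edge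 sum of them. For a class $\mathcal{G}$ of graphs, $\mathcal{G}^{(\le k)}$ is the smallest class that contains $\mathcal{G}$ and contains every graph $G$ that is a $(\le k)$-edge sum of two graphs $G_1, G_2 \in \mathcal{G}^{(\le k)}$ with $|V(G_1)|, |V(G_2)| < |V(G)|$. Let $\mathcal{A}_k$ be the class of graphs in which all vertices, except possibly one, have degree at most $k$. **Theorem.** For every graph $G$ and every integer $k \ge 0$, $G$ has no immersion of $\theta_{k+1}$ if and only if $G \in \mathcal{A}_k^{(\le k)}$. -/

import Mathlib

open scoped Graph

universe u v u' v'

namespace Graph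

/-- The standing convention on graphs: finitely many vertices and edges, and no loops.
Parallel edges are allowed. -/
structure IsFiniteLoopless {α : Type u} {β : Type v} (G : Graph α β) : Prop where
  finite_vertexSet : V(G).Finite
  finite_edgeSet : E(G).Finite
  loopless : G.Loopless

/-- The edge-degree of `x`: the number of edges incident to `x`, counted with multiplicity. -/
noncomputable def edgeDegree {α : Type u} {β : Type v} (G : Graph α β) (x : α) : ℕ :=
  (G.incidenceSet x).ncard

/-- Isomorphism of multigraphs: a bijection of the vertices and a bijection of the edges
that preserve the ends of every edge. -/
def IsIsomorphic {α : Type u} {β : Type v} {γ : Type u'} {δ : Type v'}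
    (G : Graph α β) (H : Graph γ δ) : Prop :=
  ∃ (φ : V(G) ≃ V(H)) (ψ : E(G) ≃ E(H)), ∀ (e : E(G)) (x y : V(G)),
    G.IsLink e x y ↔ H.IsLink (ψ e) (φ x) (φ y)

/-- The graph `θ_k`: two vertices joined by `k` parallel edges. -/
def theta (k : ℕ) : Graph (Fin 2) (Fin k) :=
  banana 0 1 Set.univ

/-! ### Immersions -/

/-- The result of lifting the edges `e = uv` and `f = vw`: both are removed and a new edge with
ends `u` and `w` is added. The new edge takes over the label `e`. -/
def lift {α : Type u} {β : Type v} (G : Graph α β) (e f : β) (a b c : α)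
    (he : G.IsLink e a b) (hf : G.IsLink f b c) (hef : e ≠ f) : Graph α β where
  vertexSet := V(G)
  edgeSet := E(G) \ {f}
  IsLink g x y :=
    (g = e ∧ ((x = a ∧ y = c) ∨ (x = c ∧ y = a))) ∨ (g ≠ e ∧ g ≠ f ∧ G.IsLink g x y)
  isLink_symm := by
    intro g _
    refine ⟨?_⟩
    rintro x y (⟨h, h'⟩ | ⟨h, h', h''⟩)
    · exact Or.inl ⟨h, h'.symm.imp And.symm And.symm⟩
    · exact Or.inr ⟨h, h', h''.symm⟩
  eq_or_eq_of_isLink_of_isLink := by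
    rintro g x y z w (⟨h, h'⟩ | ⟨h, -, h'⟩) (⟨k, k'⟩ | ⟨k, -, k'⟩)
    · rcases h' with ⟨rfl, rfl⟩ | ⟨rfl, rfl⟩ <;> rcases k' with ⟨rfl, rfl⟩ | ⟨rfl, rfl⟩ <;> simp
    · exact absurd h k
    · exact absurd k h
    · exact h'.left_eq_or_eq k'
  edge_mem_iff_exists_isLink := by
    intro g
    constructor
    · rintro ⟨hg, hgf⟩
      by_cases h : g = e
      · exact ⟨a, c, Or.inl ⟨h, Or.inl ⟨rfl, rfl⟩⟩⟩
      · obtain ⟨x, y, hxy⟩ := G.exists_isLink_of_mem_edgeSet hg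
        exact ⟨x, y, Or.inr ⟨h, hgf, hxy⟩⟩
    · rintro ⟨x, y, ⟨rfl, -⟩ | ⟨-, h, h'⟩⟩
      · exact ⟨he.edge_mem, hef⟩
      · exact ⟨h'.edge_mem, h⟩
  left_mem_of_isLink := by
    rintro g x y (⟨-, ⟨rfl, -⟩ | ⟨rfl, -⟩⟩ | ⟨-, -, h⟩)
    · exact he.left_mem
    · exact hf.right_mem
    · exact h.left_mem

/-- `G'` is the result of lifting two incident edges of `G`. The two edges are not parallel
(`a ≠ c`), so that the new edge is not a loop. -/
def IsLifting {α : Type u} {β : Type v} (G G' : Graph α β) : Prop :=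
  ∃ (e f : β) (a b c : α) (he : G.IsLink e a b) (hf : G.IsLink f b c) (hef : e ≠ f),
    a ≠ c ∧ G' = G.lift e f a b c he hf hef

/-- `H` is an immersion of `G`: a graph isomorphic to `H` is obtained from some subgraph `G₀` of
`G` by a series of liftings, followed by the deletion of some isolated vertices. (A lifting keeps
the common end of the two edges, which may become isolated.) -/
def IsImmersion {γ : Type u'} {δ : Type v'} {α : Type u} {β : Type v}
    (H : Graph γ δ) (G : Graph α β) : Prop :=
  ∃ G₀ G₁ G₂ : Graph α β, G₀ ≤ G ∧ Relation.ReflTransGen IsLifting G₀ G₁ ∧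
    G₂ ≤ G₁ ∧ E(G₂) = E(G₁) ∧ IsIsomorphic H G₂

/-! ### Edge sums -/

/-- The incidence relation of the disjoint union of two graphs. -/
inductive DisjointUnionLink {α₁ α₂ : Type u} {β₁ β₂ : Type v}
    (G₁ : Graph α₁ β₁) (G₂ : Graph α₂ β₂) : β₁ ⊕ β₂ → α₁ ⊕ α₂ → α₁ ⊕ α₂ → Prop
  | left {e x y} : G₁.IsLink e x y → DisjointUnionLink G₁ G₂ (.inl e) (.inl x) (.inl y)
  | right {e x y} : G₂.IsLink e x y → DisjointUnionLink G₁ G₂ (.inr e) (.inr x) (.inr y)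

/-- The disjoint union of two graphs. -/
def disjointUnion {α₁ α₂ : Type u} {β₁ β₂ : Type v}
    (G₁ : Graph α₁ β₁) (G₂ : Graph α₂ β₂) : Graph (α₁ ⊕ α₂) (β₁ ⊕ β₂) where
  vertexSet := Sum.inl '' V(G₁) ∪ Sum.inr '' V(G₂)
  IsLink := DisjointUnionLink G₁ G₂
  isLink_symm := by
    intro g _
    refine ⟨?_⟩
    rintro _ _ (h | h)
    · exact .left h.symm
    · exact .right h.symm
  eq_or_eq_of_isLink_of_isLink := by
    rintro g _ _ _ _ (h | h) (k | k)
    · simpa using h.left_eq_or_eq k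
    · simpa using h.left_eq_or_eq k
  left_mem_of_isLink := by
    rintro g _ _ (h | h)
    · exact Or.inl ⟨_, h.left_mem, rfl⟩
    · exact Or.inr ⟨_, h.left_mem, rfl⟩

/-- The incidence relation of the edge sum of `G₁` and `G₂` on `v₁` and `v₂` with respect to `σ`.
The edges that avoid `v₁` and `v₂` keep their ends. For an edge `e = v₁x` of `G₁`, with
`σ e = v₂y` in `G₂`, there is one edge with ends `x` and `y`; it takes over the label `e`. -/
inductive EdgeSumLink {α₁ α₂ : Type u} {β₁ β₂ : Type v}
    (G₁ : Graph α₁ β₁) (G₂ : Graph α₂ β₂) (v₁ : α₁) (v₂ : α₂)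
    (σ : G₁.incidenceSet v₁ ≃ G₂.incidenceSet v₂) : β₁ ⊕ β₂ → α₁ ⊕ α₂ → α₁ ⊕ α₂ → Prop
  | left {e x y} : G₁.IsLink e x y → x ≠ v₁ → y ≠ v₁ →
      EdgeSumLink G₁ G₂ v₁ v₂ σ (.inl e) (.inl x) (.inl y)
  | right {e x y} : G₂.IsLink e x y → x ≠ v₂ → y ≠ v₂ →
      EdgeSumLink G₁ G₂ v₁ v₂ σ (.inr e) (.inr x) (.inr y)
  | cross {e x y} (h : G₁.IsLink e v₁ x) : x ≠ v₁ →
      G₂.IsLink (σ ⟨e, h.inc_left⟩) v₂ y → y ≠ v₂ →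
      EdgeSumLink G₁ G₂ v₁ v₂ σ (.inl e) (.inl x) (.inr y)
  | cross_symm {e x y} (h : G₁.IsLink e v₁ x) : x ≠ v₁ →
      G₂.IsLink (σ ⟨e, h.inc_left⟩) v₂ y → y ≠ v₂ →
      EdgeSumLink G₁ G₂ v₁ v₂ σ (.inl e) (.inr y) (.inl x)

/-- The edge sum of `G₁` and `G₂` on `v₁` and `v₂` with respect to the bijection `σ` from the
edges at `v₁` to the edges at `v₂`: in the disjoint union of `G₁` and `G₂`, identify `v₁` with
`v₂`, lift each edge `e` at `v₁` with `σ e`, and remove the identified vertex. -/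
def edgeSum {α₁ α₂ : Type u} {β₁ β₂ : Type v}
    (G₁ : Graph α₁ β₁) (G₂ : Graph α₂ β₂) (v₁ : α₁) (v₂ : α₂)
    (σ : G₁.incidenceSet v₁ ≃ G₂.incidenceSet v₂) : Graph (α₁ ⊕ α₂) (β₁ ⊕ β₂) where
  vertexSet := Sum.inl '' (V(G₁) \ {v₁}) ∪ Sum.inr '' (V(G₂) \ {v₂})
  IsLink := EdgeSumLink G₁ G₂ v₁ v₂ σ
  isLink_symm := by
    intro g _
    refine ⟨?_⟩
    rintro _ _ (⟨h, hx, hy⟩ | ⟨h, hx, hy⟩ | ⟨h, hx, k, hy⟩ | ⟨h, hx, k, hy⟩)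
    · exact .left h.symm hy hx
    · exact .right h.symm hy hx
    · exact .cross_symm h hx k hy
    · exact .cross h hx k hy
  eq_or_eq_of_isLink_of_isLink := by
    have key : ∀ {e x y z}, G₁.IsLink e v₁ z → G₁.IsLink e x y → x ≠ v₁ → y ≠ v₁ → False := by
      intro e x y z h h' hx hy
      rcases h.left_eq_or_eq h' with h | h
      exacts [hx h.symm, hy h.symm]
    intro g x y z w h h'
    cases h with
    | left h hx hy =>
      cases h' with
      | left k kx ky => simpa using h.left_eq_or_eq k
      | cross k => exact (key k h hx hy).elim
      | cross_symm k => exact (key k h hx hy).elim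
    | right h hx hy =>
      cases h' with
      | right k kx ky => simpa using h.left_eq_or_eq k
    | cross h hx i hy =>
      cases h' with
      | left k kx ky => exact (key h k kx ky).elim
      | cross k kx l ly => exact Or.inl (congrArg _ (h.right_unique k))
      | cross_symm k kx l ly => exact Or.inr (congrArg _ (h.right_unique k))
    | cross_symm h hx i hy =>
      cases h' with
      | left k kx ky => exact (key h k kx ky).elim
      | cross k kx l ly => exact Or.inr (congrArg _ (i.right_unique l))
      | cross_symm k kx l ly => exact Or.inl (congrArg _ (i.right_unique l))
  left_mem_of_isLink := by
    rintro g _ _ (⟨h, hx, hy⟩ | ⟨h, hx, hy⟩ | ⟨h, hx, k, hy⟩ | ⟨h, hx, k, hy⟩)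
    · exact Or.inl ⟨_, ⟨h.left_mem, hx⟩, rfl⟩
    · exact Or.inr ⟨_, ⟨h.left_mem, hx⟩, rfl⟩
    · exact Or.inl ⟨_, ⟨h.right_mem, hx⟩, rfl⟩
    · exact Or.inr ⟨_, ⟨k.right_mem, hy⟩, rfl⟩

/-- `G` is a `(≤ k)`-edge sum of `G₁` and `G₂`: up to isomorphism, it is their disjoint union or
their `k'`-edge sum on some vertices `v₁`, `v₂` of degree `k'`, where `1 ≤ k' ≤ k`. -/
def IsEdgeSumLE (k : ℕ) {α₁ α₂ α : Type u} {β₁ β₂ β : Type v}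
    (G₁ : Graph α₁ β₁) (G₂ : Graph α₂ β₂) (G : Graph α β) : Prop :=
  IsIsomorphic G (disjointUnion G₁ G₂) ∨
  ∃ k' : ℕ, 1 ≤ k' ∧ k' ≤ k ∧ ∃ v₁ ∈ V(G₁), ∃ v₂ ∈ V(G₂),
    G₁.edgeDegree v₁ = k' ∧ G₂.edgeDegree v₂ = k' ∧
    ∃ σ : G₁.incidenceSet v₁ ≃ G₂.incidenceSet v₂, IsIsomorphic G (edgeSum G₁ G₂ v₁ v₂ σ)

/-- The `(≤ k)`-sum closure of a class `𝒢` of graphs: it contains the graphs in `𝒢` and every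
graph that is a `(≤ k)`-edge sum of two members with fewer vertices. -/
inductive SumClosure (𝒢 : ∀ (α : Type u) (β : Type v), Graph α β → Prop) (k : ℕ) :
    ∀ (α : Type u) (β : Type v), Graph α β → Prop
  | base {α : Type u} {β : Type v} (G : Graph α β) : 𝒢 α β G → SumClosure 𝒢 k α β G
  | sum {α₁ α₂ α : Type u} {β₁ β₂ β : Type v}
      (G₁ : Graph α₁ β₁) (G₂ : Graph α₂ β₂) (G : Graph α β) :
      SumClosure 𝒢 k α₁ β₁ G₁ → SumClosure 𝒢 k α₂ β₂ G₂ → IsEdgeSumLE k G₁ G₂ G →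
      V(G₁).ncard < V(G).ncard → V(G₂).ncard < V(G).ncard → SumClosure 𝒢 k α β G

/-- The class `𝒜_k` of almost `k`-bounded edge-degree graphs: all vertices, except possibly one,
have edge-degree at most `k`. -/
def AlmostBounded (k : ℕ) (α : Type u) (β : Type v) (G : Graph α β) : Prop :=
  G.IsFiniteLoopless ∧ {x ∈ V(G) | ¬ G.edgeDegree x ≤ k}.Subsingleton

end Graph

/-!
Call `G` *`k`-edge-separable* if any two of its vertices are separated by an edge cut of size at
most `k`. By Menger's theorem, `m` edge-disjoint paths between two vertices exist when there is no
smaller cut, and they can be lifted to `m` parallel edges; conversely, liftings do not increase edge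
cuts. Hence `θ_{k+1}` is not an immersion of `G` if and only if `G` is `k`-edge-separable.

Graphs in `𝒜_k` are `k`-edge-separable, since one of any two vertices has degree at most `k`, and
`(≤ k)`-edge sums preserve this property: contracting one side of the sum recovers the other
summand, and the cut between the two sides has size at most `k`. Conversely, if a `k`-edge-separable
graph has two vertices `u` and `v` of degree greater than `k`, take a minimum cut between `u` and
`v`. If it is empty, then `G` is a disjoint union. Otherwise `G` is the edge sum of the two graphs
obtained by identifying all vertices on the side of `v` with `v`, respectively all vertices on the
side of `u` with `u`. These graphs are `k`-edge-separable because other cuts can be uncrossed with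
the minimum cut, and they have fewer vertices because neither side of the cut is a single vertex.
-/

namespace ThetaImmersion

open Graph

section EdgeCut

variable {α : Type u} {β : Type v} {G : Graph α β} {S T : Set α} {e : β} {a b : α}

/-- The set of edges of `G` with one end in `S` and one end in `T`. -/
def edgesBetween (G : Graph α β) (S T : Set α) : Set β :=
  {e | ∃ a b, G.IsLink e a b ∧ a ∈ S ∧ b ∈ T}

/-- The edge cut of `G` defined by `S`, usually written `δ(S)`. It is convenient that `S` need not
consist of vertices of `G`. -/
def edgeCut (G : Graph α β) (S : Set α) : Set β :=
  edgesBetween G S Sᶜ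

/-- The set of edges of `G` with at least one end in `S`. -/
def edgesMeeting (G : Graph α β) (S : Set α) : Set β :=
  {e | ∃ a ∈ S, G.Inc e a}

theorem edgesBetween_subset_edgeSet (G : Graph α β) (S T : Set α) : edgesBetween G S T ⊆ E(G) := by
  rintro e ⟨a, b, h, -⟩
  exact h.edge_mem

theorem edgeCut_subset_edgeSet (G : Graph α β) (S : Set α) : edgeCut G S ⊆ E(G) :=
  edgesBetween_subset_edgeSet G S Sᶜ

theorem edgesMeeting_subset_edgeSet (G : Graph α β) (S : Set α) : edgesMeeting G S ⊆ E(G) := by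
  rintro e ⟨a, -, h⟩
  exact h.edge_mem

theorem mem_edgesBetween_iff (h : G.IsLink e a b) :
    e ∈ edgesBetween G S T ↔ a ∈ S ∧ b ∈ T ∨ b ∈ S ∧ a ∈ T := by
  constructor
  · rintro ⟨a', b', h', ha, hb⟩
    rcases h.eq_and_eq_or_eq_and_eq h' with ⟨rfl, rfl⟩ | ⟨rfl, rfl⟩
    exacts [Or.inl ⟨ha, hb⟩, Or.inr ⟨ha, hb⟩]
  · rintro (⟨ha, hb⟩ | ⟨hb, ha⟩)
    exacts [⟨a, b, h, ha, hb⟩, ⟨b, a, h.symm, hb, ha⟩]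

theorem mem_edgeCut_iff (h : G.IsLink e a b) : e ∈ edgeCut G S ↔ ¬(a ∈ S ↔ b ∈ S) := by
  rw [edgeCut, mem_edgesBetween_iff h, Set.mem_compl_iff, Set.mem_compl_iff]
  tauto

theorem mem_edgesMeeting_iff (h : G.IsLink e a b) : e ∈ edgesMeeting G S ↔ a ∈ S ∨ b ∈ S := by
  constructor
  · rintro ⟨c, hc, hi⟩
    rcases hi.eq_or_eq_of_isLink h with rfl | rfl
    exacts [Or.inl hc, Or.inr hc]
  · rintro (ha | hb)
    exacts [⟨a, ha, h.inc_left⟩, ⟨b, hb, h.inc_right⟩]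

theorem eq_of_forall_isLink_mem_iff {A B : Set β} (hA : A ⊆ E(G)) (hB : B ⊆ E(G))
    (h : ∀ e a b, G.IsLink e a b → (e ∈ A ↔ e ∈ B)) : A = B := by
  ext e
  by_cases he : e ∈ E(G)
  · obtain ⟨a, b, hl⟩ := G.exists_isLink_of_mem_edgeSet he
    exact h e a b hl
  · exact iff_of_false (fun h => he (hA h)) fun h => he (hB h)

theorem edgeCut_compl (G : Graph α β) (S : Set α) : edgeCut G Sᶜ = edgeCut G S := by
  refine eq_of_forall_isLink_mem_iff (edgeCut_subset_edgeSet G _) (edgeCut_subset_edgeSet G _)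
    fun e a b h => ?_
  rw [mem_edgeCut_iff h, mem_edgeCut_iff h, Set.mem_compl_iff, Set.mem_compl_iff, not_iff_not,
    not_iff_not]

theorem edgeCut_deleteEdges (G : Graph α β) (F : Set β) (S : Set α) :
    edgeCut (G.deleteEdges F) S = edgeCut G S \ F := by
  ext e
  simp only [edgeCut, edgesBetween, deleteEdges_isLink, Set.mem_ofPred_eq, Set.mem_sdiff]
  tauto

/-- An edge counted on the right but not on the left joins `S \ T` to `T \ S`; it is counted in
both cuts on the right. -/
theorem encard_edgeCut_inter_add_encard_edgeCut_union (G : Graph α β) (S T : Set α) :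
    (edgeCut G (S ∩ T)).encard + (edgeCut G (S ∪ T)).encard +
        2 * (edgesBetween G (S \ T) (T \ S)).encard =
      (edgeCut G S).encard + (edgeCut G T).encard := by
  set M := edgesBetween G (S \ T) (T \ S) with hM
  have hcut := edgeCut_subset_edgeSet G
  have hunion : edgeCut G (S ∩ T) ∪ edgeCut G (S ∪ T) = (edgeCut G S ∪ edgeCut G T) \ M := by
    refine eq_of_forall_isLink_mem_iff (Set.union_subset (hcut _) (hcut _))
      (Set.sdiff_subset.trans (Set.union_subset (hcut _) (hcut _))) fun e a b h => ?_
    simp only [hM, Set.mem_union, Set.mem_inter_iff, Set.mem_sdiff, mem_edgeCut_iff h,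
      mem_edgesBetween_iff h]
    tauto
  have hinter : edgeCut G (S ∩ T) ∩ edgeCut G (S ∪ T) = (edgeCut G S ∩ edgeCut G T) \ M := by
    refine eq_of_forall_isLink_mem_iff (Set.inter_subset_left.trans (hcut _))
      (Set.sdiff_subset.trans (Set.inter_subset_left.trans (hcut _))) fun e a b h => ?_
    simp only [hM, Set.mem_union, Set.mem_inter_iff, Set.mem_sdiff, mem_edgeCut_iff h,
      mem_edgesBetween_iff h]
    tauto
  have hsub : M ⊆ edgeCut G S ∩ edgeCut G T := by
    rintro e ⟨a, b, h, ha, hb⟩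
    exact ⟨⟨a, b, h, ha.1, hb.2⟩, ⟨b, a, h.symm, hb.1, ha.2⟩⟩
  have hsub' : M ⊆ edgeCut G S ∪ edgeCut G T :=
    hsub.trans (Set.inter_subset_left.trans Set.subset_union_left)
  rw [← Set.encard_union_add_encard_inter, hunion, hinter,
    ← Set.encard_union_add_encard_inter (edgeCut G S), ← Set.encard_sdiff_add_encard_of_subset hsub,
    ← Set.encard_sdiff_add_encard_of_subset hsub']
  ring

theorem encard_edgeCut_inter_add_encard_edgeCut_union_le (G : Graph α β) (S T : Set α) :
    (edgeCut G (S ∩ T)).encard + (edgeCut G (S ∪ T)).encard ≤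
      (edgeCut G S).encard + (edgeCut G T).encard :=
  le_self_add.trans (encard_edgeCut_inter_add_encard_edgeCut_union G S T).le

/-- A map that contracts parts of `G` creates no edges, so cuts do not grow when pulled back. -/
theorem encard_edgeCut_preimage_le {γ : Type u'} {δ : Type v'} {H : Graph γ δ} (f : α → γ)
    (g : E(H) → β)
    (h : ∀ e a b, G.IsLink e a b → f a ≠ f b → ∃ d, g d = e ∧ H.IsLink d (f a) (f b))
    (S : Set γ) : (edgeCut G (f ⁻¹' S)).encard ≤ (edgeCut H S).encard := by
  have hsub : edgeCut G (f ⁻¹' S) ⊆ g '' (Subtype.val ⁻¹' edgeCut H S) := by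
    rintro e ⟨a, b, hab, ha, hb⟩
    obtain ⟨d, rfl, hd⟩ := h e a b hab fun heq => hb (heq ▸ ha : f b ∈ S)
    exact ⟨d, ⟨_, _, hd, ha, hb⟩, rfl⟩
  exact (Set.encard_le_encard hsub).trans
    ((Set.encard_image_le _ _).trans (Set.encard_preimage_val_le_encard_right _ _))

end EdgeCut

section EdgeReachable

variable {α : Type u} {β : Type v} {G H : Graph α β} {S X W : Set α} {x y : α} {m k : ℕ}

/-- `x` and `y` are `m`-edge-reachable in `G` if every edge cut separating them has size at least
`m`. The size is an extended natural number, so that infinite cuts count as large. -/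
def IsEdgeReachable (G : Graph α β) (m : ℕ) (x y : α) : Prop :=
  ∀ S : Set α, x ∈ S → y ∉ S → m ≤ (edgeCut G S).encard

/-- Any two vertices of `G` can be separated by an edge cut of size at most `k`. -/
def EdgeSeparable (G : Graph α β) (k : ℕ) : Prop :=
  ∀ x ∈ V(G), ∀ y ∈ V(G), x ≠ y → ¬IsEdgeReachable G (k + 1) x y

/-- `X` defines an edge cut of minimum size among those that separate `x` from `y`. -/
structure IsMinCut (G : Graph α β) (x y : α) (X : Set α) : Prop where
  mem : x ∈ X
  notMem : y ∉ X
  le : ∀ S : Set α, x ∈ S → y ∉ S → (edgeCut G X).encard ≤ (edgeCut G S).encard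

theorem not_isEdgeReachable_add_one_iff :
    ¬IsEdgeReachable G (k + 1) x y ↔ ∃ S : Set α, x ∈ S ∧ y ∉ S ∧ (edgeCut G S).encard ≤ k := by
  simp only [IsEdgeReachable, not_forall, not_le, exists_prop, Nat.cast_add, Nat.cast_one,
    ENat.lt_natCast_add_one_iff]

theorem not_isEdgeReachable_of_encard_edgeCut_le (hS : ¬(x ∈ S ↔ y ∈ S))
    (hk : (edgeCut G S).encard ≤ k) : ¬IsEdgeReachable G (k + 1) x y := by
  rw [not_isEdgeReachable_add_one_iff]
  by_cases hx : x ∈ S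
  · exact ⟨S, hx, by tauto, hk⟩
  · exact ⟨Sᶜ, hx, fun hy => hy (by tauto), by rwa [edgeCut_compl]⟩

theorem IsEdgeReachable.map {γ : Type u'} {δ : Type v'} {H : Graph γ δ}
    (hG : IsEdgeReachable G m x y) (f : α → γ) (g : E(H) → β)
    (h : ∀ e a b, G.IsLink e a b → f a ≠ f b → ∃ d, g d = e ∧ H.IsLink d (f a) (f b)) :
    IsEdgeReachable H m (f x) (f y) := fun S hx hy =>
  (hG (f ⁻¹' S) hx hy).trans (encard_edgeCut_preimage_le f g h S)

theorem IsEdgeReachable.mono (h : IsEdgeReachable G m x y) (hle : G ≤ H) :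
    IsEdgeReachable H m x y :=
  h.map id Subtype.val fun e _ _ hl _ => ⟨⟨e, (hl.mono hle).edge_mem⟩, rfl, hl.mono hle⟩

theorem EdgeSeparable.mono (hH : EdgeSeparable H k) (hle : G ≤ H) : EdgeSeparable G k :=
  fun x hx y hy hxy h =>
    hH x (hle.vertexSet_mono hx) y (hle.vertexSet_mono hy) hxy (h.mono hle)

theorem EdgeSeparable.exists_encard_edgeCut_le (hG : EdgeSeparable G k) (hx : x ∈ V(G))
    (hy : y ∈ V(G)) (hxy : x ≠ y) (v : α) :
    ∃ S : Set α, v ∉ S ∧ ¬(x ∈ S ↔ y ∈ S) ∧ (edgeCut G S).encard ≤ k := by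
  obtain ⟨S, hxS, hyS, hSk⟩ := not_isEdgeReachable_add_one_iff.1 (hG x hx y hy hxy)
  by_cases hv : v ∈ S
  · exact ⟨Sᶜ, fun h => h hv, by simp [hxS, hyS], by rwa [edgeCut_compl]⟩
  · exact ⟨S, hv, by simp [hxS, hyS], hSk⟩

theorem exists_isMinCut (G : Graph α β) (hxy : x ≠ y) : ∃ X, IsMinCut G x y X := by
  obtain ⟨X, ⟨hx, hy⟩, hX⟩ := exists_minimalFor_of_wellFoundedLT
    (fun S : Set α => x ∈ S ∧ y ∉ S) (fun S => (edgeCut G S).encard) ⟨{x}, rfl, hxy.symm⟩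
  exact ⟨X, hx, hy, fun S hxS hyS => (le_total _ _).elim id (hX ⟨hxS, hyS⟩)⟩

theorem IsMinCut.compl (hX : IsMinCut G x y X) : IsMinCut G y x Xᶜ where
  mem := hX.notMem
  notMem h := h hX.mem
  le S hy hx := by
    rw [edgeCut_compl, ← edgeCut_compl G S]
    exact hX.le Sᶜ hx fun h => h hy

theorem IsMinCut.encard_edgeCut_inter_le (hX : IsMinCut G x y X) (hfin : (edgeCut G X).Finite)
    (hy : y ∉ S) : (edgeCut G (X ∩ S)).encard ≤ (edgeCut G S).encard := by
  have hunion := hX.le (X ∪ S) (Or.inl hX.mem) fun h => h.elim hX.notMem hy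
  refine (ENat.add_le_add_iff_left hfin.encard_lt_top.ne).1 (le_trans ?_
    (encard_edgeCut_inter_add_encard_edgeCut_union_le G X S))
  rw [add_comm]
  exact add_le_add_right hunion _

theorem IsMinCut.union (hX : IsMinCut G x y X) (hW : IsMinCut G x y W)
    (hfin : (edgeCut G X).Finite) : IsMinCut G x y (X ∪ W) := by
  have hy : y ∉ X ∪ W := fun h => h.elim hX.notMem hW.notMem
  refine ⟨Or.inl hX.mem, hy, fun S hxS hyS => le_trans ?_ (hW.le S hxS hyS)⟩
  have := hX.compl.encard_edgeCut_inter_le (S := Wᶜ) (by rwa [edgeCut_compl]) fun h => h hW.mem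
  rwa [← Set.compl_union, edgeCut_compl, edgeCut_compl] at this

end EdgeReachable

section Lifting

variable {α : Type u} {β : Type v} {G G' : Graph α β} {S : Set α} {e f g : β} {a b c x y : α}
  {m : ℕ}

theorem lift_isLink_self (he : G.IsLink e a b) (hf : G.IsLink f b c) (hef : e ≠ f) :
    (G.lift e f a b c he hf hef).IsLink e a c :=
  Or.inl ⟨rfl, Or.inl ⟨rfl, rfl⟩⟩

theorem lift_isLink_iff_of_ne (he : G.IsLink e a b) (hf : G.IsLink f b c) (hef : e ≠ f)
    (hge : g ≠ e) : (G.lift e f a b c he hf hef).IsLink g x y ↔ g ≠ f ∧ G.IsLink g x y := by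
  simp [lift, hge]

theorem mem_edgeCut_lift_iff_of_ne (he : G.IsLink e a b) (hf : G.IsLink f b c) (hef : e ≠ f)
    (hge : g ≠ e) : g ∈ edgeCut (G.lift e f a b c he hf hef) S ↔ g ≠ f ∧ g ∈ edgeCut G S := by
  simp only [edgeCut, edgesBetween, Set.mem_ofPred_eq, lift_isLink_iff_of_ne he hf hef hge]
  tauto

theorem self_mem_edgeCut_lift_iff (he : G.IsLink e a b) (hf : G.IsLink f b c) (hef : e ≠ f) :
    e ∈ edgeCut (G.lift e f a b c he hf hef) S ↔ (e ∈ edgeCut G S ↔ f ∉ edgeCut G S) := by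
  rw [mem_edgeCut_iff (lift_isLink_self he hf hef), mem_edgeCut_iff he, mem_edgeCut_iff hf]
  tauto

theorem encard_edgeCut_lift_add_two (he : G.IsLink e a b) (hf : G.IsLink f b c) (hef : e ≠ f)
    (heS : e ∈ edgeCut G S) (hfS : f ∈ edgeCut G S) :
    (edgeCut (G.lift e f a b c he hf hef) S).encard + 2 = (edgeCut G S).encard := by
  have hcut : edgeCut (G.lift e f a b c he hf hef) S = edgeCut G S \ {e, f} := by
    ext g
    by_cases hge : g = e
    · simp [hge, self_mem_edgeCut_lift_iff he hf hef, heS, hfS]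
    · rw [mem_edgeCut_lift_iff_of_ne he hf hef hge]
      simp only [Set.mem_sdiff, Set.mem_insert_iff, Set.mem_singleton_iff]
      tauto
  rw [hcut, ← Set.encard_pair hef]
  exact Set.encard_sdiff_add_encard_of_subset (Set.pair_subset heS hfS)

theorem encard_edgeCut_lift (he : G.IsLink e a b) (hf : G.IsLink f b c) (hef : e ≠ f)
    (hS : ¬(e ∈ edgeCut G S ∧ f ∈ edgeCut G S)) :
    (edgeCut (G.lift e f a b c he hf hef) S).encard = (edgeCut G S).encard := by
  by_cases hfS : f ∈ edgeCut G S
  · have heS : e ∉ edgeCut G S := fun heS => hS ⟨heS, hfS⟩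
    rw [← Set.encard_exchange heS hfS]
    congr 1
    ext g
    by_cases hge : g = e
    · simp [hge, self_mem_edgeCut_lift_iff he hf hef, heS, hfS]
    · rw [mem_edgeCut_lift_iff_of_ne he hf hef hge]
      simp only [Set.mem_insert_iff, Set.mem_sdiff, Set.mem_singleton_iff]
      tauto
  · congr 1
    ext g
    by_cases hge : g = e
    · rw [hge, self_mem_edgeCut_lift_iff he hf hef, iff_true_right hfS]
    · rw [mem_edgeCut_lift_iff_of_ne he hf hef hge, and_iff_right_iff_imp]
      rintro hg rfl
      exact hfS hg

theorem encard_edgeCut_lift_le (he : G.IsLink e a b) (hf : G.IsLink f b c) (hef : e ≠ f) :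
    (edgeCut (G.lift e f a b c he hf hef) S).encard ≤ (edgeCut G S).encard := by
  by_cases hS : e ∈ edgeCut G S ∧ f ∈ edgeCut G S
  · exact le_self_add.trans (encard_edgeCut_lift_add_two he hf hef hS.1 hS.2).le
  · exact (encard_edgeCut_lift he hf hef hS).le

theorem vertexSet_eq_of_isLifting (h : IsLifting G G') : V(G') = V(G) := by
  obtain ⟨e, f, a, b, c, he, hf, hef, -, rfl⟩ := h
  rfl

theorem IsEdgeReachable.of_isLifting (hG' : IsEdgeReachable G' m x y) (h : IsLifting G G') :
    IsEdgeReachable G m x y := by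
  obtain ⟨e, f, a, b, c, he, hf, hef, -, rfl⟩ := h
  exact fun S hx hy => (hG' S hx hy).trans (encard_edgeCut_lift_le he hf hef)

theorem EdgeSeparable.of_isLifting {k : ℕ} (hG : EdgeSeparable G k) (h : IsLifting G G') :
    EdgeSeparable G' k := by
  intro x hx y hy hxy hr
  rw [vertexSet_eq_of_isLifting h] at hx hy
  exact hG x hx y hy hxy (hr.of_isLifting h)

/-- The lifted pair must lie in the cut that the lifting makes too small. -/
theorem exists_encard_edgeCut_le_of_not_isEdgeReachable_lift (hm : IsEdgeReachable G m x y)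
    (he : G.IsLink e x b) (hf : G.IsLink f b c) (hef : e ≠ f)
    (hl : ¬IsEdgeReachable (G.lift e f x b c he hf hef) m x y) :
    ∃ S : Set α, x ∈ S ∧ y ∉ S ∧ b ∉ S ∧ c ∈ S ∧ (edgeCut G S).encard ≤ m + 1 := by
  simp only [IsEdgeReachable, not_forall, not_le, exists_prop] at hl
  obtain ⟨S, hxS, hyS, hS⟩ := hl
  have hmS := hm S hxS hyS
  by_cases hef' : e ∈ edgeCut G S ∧ f ∈ edgeCut G S
  · have hcount := encard_edgeCut_lift_add_two he hf hef hef'.1 hef'.2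
    rw [mem_edgeCut_iff he, mem_edgeCut_iff hf] at hef'
    refine ⟨S, hxS, hyS, by tauto, by tauto, ?_⟩
    rw [← hcount, ← one_add_one_eq_two, ← add_assoc]
    exact add_le_add_left (Order.add_one_le_of_lt hS) 1
  · rw [encard_edgeCut_lift he hf hef hef'] at hS
    exact absurd hS hmS.not_gt

theorem exists_reflTransGen_isLifting_restrict (h : IsLifting G G') (F : Set β) :
    ∃ F', Relation.ReflTransGen IsLifting (G.restrict F') (G'.restrict F) := by
  obtain ⟨e, f, a, b, c, he, hf, hef, hac, rfl⟩ := h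
  by_cases heF : e ∈ F
  · have he' : (G.restrict (insert f F)).IsLink e a b := by simp [heF, he]
    have hf' : (G.restrict (insert f F)).IsLink f b c := by simp [hf]
    refine ⟨insert f F, .single ⟨e, f, a, b, c, he', hf', hef, hac, Graph.ext rfl fun g x y => ?_⟩⟩
    by_cases hge : g = e
    · simp [hge, lift, heF]
    · rw [restrict_isLink, lift_isLink_iff_of_ne he' hf' hef hge, restrict_isLink,
        lift_isLink_iff_of_ne he hf hef hge, Set.mem_insert_iff]
      tauto
  · have heq : (G.lift e f a b c he hf hef).restrict F = G.restrict (F \ {f}) := by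
      refine Graph.ext rfl fun g x y => ?_
      by_cases hge : g = e
      · simp [hge, heF]
      · rw [restrict_isLink, restrict_isLink, lift_isLink_iff_of_ne he hf hef hge, Set.mem_sdiff,
          Set.mem_singleton_iff]
        tauto
    exact ⟨F \ {f}, heq ▸ .refl⟩

end Lifting

section Menger

variable {α : Type u} {β : Type v} {G : Graph α β} {X : Set α} {e g : β} {b x y : α} {m : ℕ}

theorem IsEdgeReachable.exists_isMinCut_of_not_deleteEdges (hm : IsEdgeReachable G m x y)
    (hg : ¬IsEdgeReachable (G.deleteEdges {g}) m x y) :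
    ∃ S, IsMinCut G x y S ∧ g ∈ edgeCut G S ∧ (edgeCut G S).encard = m := by
  simp only [IsEdgeReachable, edgeCut_deleteEdges, not_forall, not_le, exists_prop] at hg
  obtain ⟨S, hxS, hyS, hS⟩ := hg
  have hgS : g ∈ edgeCut G S := by
    by_contra hgS
    rw [Set.sdiff_singleton_eq_self hgS] at hS
    exact (hm S hxS hyS).not_gt hS
  have hSm : (edgeCut G S).encard = m := by
    refine le_antisymm ?_ (hm S hxS hyS)
    rw [← Set.encard_sdiff_singleton_add_one hgS]
    exact Order.add_one_le_of_lt hS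
  exact ⟨S, ⟨hxS, hyS, fun T hxT hyT => hSm.trans_le (hm T hxT hyT)⟩, hgS, hSm⟩

/-- Minimum cuts are closed under unions, so one may take a cut meeting as many edges as
possible. -/
theorem exists_isMinCut_forall_isLink_mem (hE : E(G).Finite) (hX : IsMinCut G x y X)
    (hbX : b ∉ X) :
    ∃ Y, IsMinCut G x y Y ∧ b ∉ Y ∧
      ∀ W f c, IsMinCut G x y W → b ∉ W → G.IsLink f b c → c ∈ W → c ∈ Y := by
  have hfin : (edgesMeeting G '' {Y | IsMinCut G x y Y ∧ b ∉ Y}).Finite :=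
    hE.finite_subsets.subset (Set.image_subset_iff.2 fun Y _ => edgesMeeting_subset_edgeSet G Y)
  obtain ⟨Y, ⟨hY, hbY⟩, hmax⟩ := hfin.exists_maximalFor' _ _ ⟨X, hX, hbX⟩
  refine ⟨Y, hY, hbY, fun W f c hW hbW hf hcW => ?_⟩
  have hle : edgesMeeting G Y ≤ edgesMeeting G (Y ∪ W) := fun e ⟨a, ha, hi⟩ => ⟨a, Or.inl ha, hi⟩
  have hfY := hmax ⟨hY.union hW (hE.subset (edgeCut_subset_edgeSet G Y)), by simp [hbY, hbW]⟩ hle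
    ⟨c, Or.inr hcW, hf.inc_right⟩
  exact ((mem_edgesMeeting_iff hf).1 hfY).resolve_left hbY

theorem IsMinCut.exists_isLink_notMem (hX : IsMinCut G x y X) (hfin : (edgeCut G X).Finite)
    (he : G.IsLink e x b) (hbX : b ∉ X) (hby : b ≠ y) : ∃ f c, G.IsLink f b c ∧ c ∉ X := by
  by_contra! hno
  have heX : e ∈ edgeCut G X := ⟨x, b, he, hX.mem, hbX⟩
  have hsub : edgeCut G (insert b X) ⊆ edgeCut G X \ {e} := by
    rintro g ⟨p, q, hpq, rfl | hp, hq⟩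
    · exact absurd (Or.inr (hno g q hpq)) hq
    · refine ⟨⟨p, q, hpq, hp, fun h => hq (Or.inr h)⟩, ?_⟩
      rintro rfl
      rcases hpq.right_eq_or_eq he with rfl | rfl
      exacts [hq (Or.inr hX.mem), hq (Or.inl rfl)]
  have hle : (edgeCut G X).encard ≤ (edgeCut G X \ {e}).encard :=
    (hX.le _ (Or.inr hX.mem) fun h => h.elim (fun h => hby h.symm) hX.notMem).trans
      (Set.encard_le_encard hsub)
  exact hle.not_gt (hfin.sdiff.encard_lt_encard (Set.sdiff_singleton_ssubset.2 heX))

/-- In an edge-critical graph, choose a minimum cut `X` as in `exists_isMinCut_forall_isLink_mem`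
and lift `e` with an edge `f = bc` leaving `X`. If this fails, then a cut that is at most one larger
than a minimum cut contains `e` and `f`, and uncrossing it with a minimum cut through `f` yields a
contradiction. -/
theorem exists_deleteEdges_or_lift (hE : E(G).Finite) (hm : IsEdgeReachable G m x y)
    (he : G.IsLink e x b) (hby : b ≠ y) :
    (∃ g ∈ E(G), IsEdgeReachable (G.deleteEdges {g}) m x y) ∨
    ∃ (f : β) (c : α) (hf : G.IsLink f b c) (hef : e ≠ f), x ≠ c ∧
      IsEdgeReachable (G.lift e f x b c he hf hef) m x y := by
  by_contra! ⟨hdel, hlift⟩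
  obtain ⟨X₀, hX₀, heX₀, -⟩ := hm.exists_isMinCut_of_not_deleteEdges (hdel e he.edge_mem)
  have hbX₀ : b ∉ X₀ := fun h => (mem_edgeCut_iff he).1 heX₀ (iff_of_true hX₀.mem h)
  obtain ⟨X, hX, hbX, hmax⟩ := exists_isMinCut_forall_isLink_mem hE hX₀ hbX₀
  obtain ⟨f, c, hf, hcX⟩ :=
    hX.exists_isLink_notMem (hE.subset (edgeCut_subset_edgeSet G X)) he hbX hby
  have hxc : x ≠ c := fun h => hcX (h ▸ hX.mem)
  have hef : e ≠ f := by
    rintro rfl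
    exact hxc (he.symm.right_unique hf)
  obtain ⟨S, hxS, hyS, hbS, hcS, hSm⟩ :=
    exists_encard_edgeCut_le_of_not_isEdgeReachable_lift hm he hf hef (hlift f c hf hef hxc)
  obtain ⟨W, hW, hfW, hWm⟩ := hm.exists_isMinCut_of_not_deleteEdges (hdel f hf.edge_mem)
  have hcW : c ∉ W := fun hcW =>
    hcX (hmax W f c hW (fun hbW => (mem_edgeCut_iff hf).1 hfW (iff_of_true hbW hcW)) hf hcW)
  have hbW : b ∈ W := by
    rw [mem_edgeCut_iff hf] at hfW
    tauto
  have hfSW : 1 ≤ (edgesBetween G (S \ W) (W \ S)).encard :=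
    Set.one_le_encard_iff_nonempty.2 ⟨f, c, b, hf.symm, ⟨hcS, hcW⟩, hbW, hbS⟩
  have hinter := hm (S ∩ W) ⟨hxS, hW.mem⟩ fun h => hyS h.1
  have hunion := hm (S ∪ W) (Or.inl hxS) fun h => h.elim hyS hW.notMem
  have hcount : (m + m + 2 * 1 : ℕ∞) ≤ (m + 1) + m := calc
    _ ≤ (edgeCut G (S ∩ W)).encard + (edgeCut G (S ∪ W)).encard +
        2 * (edgesBetween G (S \ W) (W \ S)).encard := by gcongr
    _ = (edgeCut G S).encard + (edgeCut G W).encard :=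
        encard_edgeCut_inter_add_encard_edgeCut_union G S W
    _ ≤ (m + 1) + m := by gcongr; exact hWm.le
  norm_cast at hcount
  omega

/-- The edge version of Menger's theorem, with the paths already lifted to parallel edges. -/
theorem IsEdgeReachable.exists_reflTransGen_isLifting_banana_le (hm : IsEdgeReachable G m x y)
    (hE : E(G).Finite) (hx : x ∈ V(G)) (hy : y ∈ V(G)) (hxy : x ≠ y) :
    ∃ F G₁, Relation.ReflTransGen IsLifting (G.restrict F) G₁ ∧ banana x y E(G₁) ≤ G₁ ∧
      E(G₁).encard = m := by
  induction hn : E(G).ncard using Nat.strong_induction_on generalizing G with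
  | _ n ih =>
  subst hn
  by_cases hthird : ∃ e b, G.IsLink e x b ∧ b ≠ y
  · obtain ⟨e, b, he, hby⟩ := hthird
    rcases exists_deleteEdges_or_lift hE hm he hby with
      ⟨g, hg, hdel⟩ | ⟨f, c, hf, hef, hxc, hlift⟩
    · obtain ⟨F, G₁, hF, hG₁⟩ := ih _ (Set.ncard_sdiff_singleton_lt_of_mem hg hE)
        (G := G.deleteEdges {g}) hdel hE.sdiff hx hy (by simp)
      rw [← restrict_edgeSet_sdiff_eq_deleteEdges, restrict_restrict] at hF
      exact ⟨_, G₁, hF, hG₁⟩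
    · obtain ⟨F, G₁, hF, hG₁⟩ := ih _ (Set.ncard_sdiff_singleton_lt_of_mem hf.edge_mem hE)
        hlift hE.sdiff hx hy rfl
      obtain ⟨F', hF'⟩ :=
        exists_reflTransGen_isLifting_restrict ⟨e, f, x, b, c, he, hf, hef, hxc, rfl⟩ F
      exact ⟨F', G₁, hF'.trans hF, hG₁⟩
  · push Not at hthird
    obtain ⟨D, hD, hDm⟩ := Set.exists_subset_encard_eq (hm {x} rfl fun h => hxy h.symm)
    have hDE : E(G.restrict D) = D := by
      simpa using hD.trans (edgeCut_subset_edgeSet G {x})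
    refine ⟨D, G.restrict D, .refl, ⟨by simp [Set.insert_subset_iff, hx, hy], ?_⟩, by rwa [hDE]⟩
    intro e p q h
    rw [banana_isLink, hDE] at h
    obtain ⟨a, b, hab, rfl, hb⟩ := hD h.1
    obtain rfl := hthird e b hab
    rcases h with ⟨heD, ⟨rfl, rfl⟩ | ⟨rfl, rfl⟩⟩
    exacts [⟨heD, hab⟩, ⟨heD, hab.symm⟩]

end Menger

section Isomorphism

variable {α : Type u} {β : Type v} {γ : Type u'} {δ : Type v'} {G : Graph α β} {H : Graph γ δ}
  {k m : ℕ} {x y : α}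

theorem isIsomorphic_of_injective (f : α → γ) (g : β → δ) (hf : f.Injective) (hg : g.Injective)
    (hV : V(H) = f '' V(G)) (hE : E(H) ⊆ g '' E(G))
    (hlink : ∀ e a b, G.IsLink e a b → H.IsLink (g e) (f a) (f b)) : IsIsomorphic G H := by
  have hE' : E(H) = g '' E(G) := by
    refine hE.antisymm ?_
    rintro _ ⟨e, he, rfl⟩
    obtain ⟨a, b, h⟩ := G.exists_isLink_of_mem_edgeSet he
    exact (hlink e a b h).edge_mem
  refine ⟨(Equiv.Set.image f V(G) hf).trans (Equiv.setCongr hV.symm),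
    (Equiv.Set.image g E(G) hg).trans (Equiv.setCongr hE'.symm), fun e x y => ⟨hlink e x y, ?_⟩⟩
  intro (h : H.IsLink (g e) (f x) (f y))
  obtain ⟨a, b, hab⟩ := G.exists_isLink_of_mem_edgeSet e.2
  rcases (hlink e a b hab).eq_and_eq_or_eq_and_eq h with ⟨ha, hb⟩ | ⟨ha, hb⟩
  · rwa [← hf ha, ← hf hb]
  · rw [← hf ha, ← hf hb]
    exact hab.symm

open Classical in
theorem EdgeSeparable.of_isIsomorphic (hH : EdgeSeparable H k) (h : IsIsomorphic G H) :
    EdgeSeparable G k := by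
  obtain ⟨φ, ψ, hφψ⟩ := h
  intro x hx y hy hxy hreach
  let f : α → γ := fun a => if ha : a ∈ V(G) then φ ⟨a, ha⟩ else φ ⟨x, hx⟩
  have hf : ∀ {a} (ha : a ∈ V(G)), f a = φ ⟨a, ha⟩ := fun ha => dif_pos ha
  have hreach' : IsEdgeReachable H (k + 1) (f x) (f y) := by
    refine hreach.map f (fun d => ψ.symm d) fun e a b h _ => ⟨ψ ⟨e, h.edge_mem⟩, by simp, ?_⟩
    rw [hf h.left_mem, hf h.right_mem]
    exact (hφψ ⟨e, h.edge_mem⟩ ⟨a, h.left_mem⟩ ⟨b, h.right_mem⟩).1 h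
  rw [hf hx, hf hy] at hreach'
  refine hH _ (φ ⟨x, hx⟩).2 _ (φ ⟨y, hy⟩).2 (fun heq => hxy ?_) hreach'
  exact congrArg Subtype.val (φ.injective (Subtype.ext heq))

theorem isIsomorphic_theta_banana (hxy : x ≠ y) {F : Set β} (hF : F.encard = m) :
    IsIsomorphic (theta m) (banana x y F) := by
  have hfin : Finite F := (Set.finite_of_encard_eq_coe hF).to_subtype
  have hcard : Nat.card F = m := by
    rw [Nat.card_coe_set_eq, Set.ncard, hF, ENat.toNat_natCast]
  let ψ : Fin m ≃ F := (Finite.equivFinOfCardEq hcard).symm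
  refine isIsomorphic_of_injective ![x, y] (fun i => ψ i) ?_
    (Subtype.val_injective.comp ψ.injective) ?_ ?_ ?_
  · simp [Function.Injective, Fin.forall_fin_two, hxy, hxy.symm]
  · simp [theta, Set.image_pair]
  · intro e he
    rw [edgeSet_banana] at he
    exact ⟨ψ.symm ⟨e, he⟩, by simp [theta], by simp⟩
  · intro i a b h
    simp only [theta, banana_isLink] at h
    rcases h.2 with ⟨rfl, rfl⟩ | ⟨rfl, rfl⟩ <;> simp

end Isomorphism

section Immersion

variable {α : Type u} {β : Type v} {G : Graph α β} {k m : ℕ} {x y : α}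

theorem isEdgeReachable_theta (m : ℕ) : IsEdgeReachable (theta m) m 0 1 := by
  intro S h₀ h₁
  have hcut : edgeCut (theta m) S = Set.univ :=
    Set.eq_univ_of_forall fun e => ⟨0, 1, by simp [theta], h₀, h₁⟩
  simp [hcut]

theorem IsEdgeReachable.isImmersion_theta (hm : IsEdgeReachable G m x y) (hE : E(G).Finite)
    (hx : x ∈ V(G)) (hy : y ∈ V(G)) (hxy : x ≠ y) : IsImmersion (theta m) G := by
  obtain ⟨F, G₁, hlift, hle, hcard⟩ := hm.exists_reflTransGen_isLifting_banana_le hE hx hy hxy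
  exact ⟨_, G₁, banana x y E(G₁), restrict_le, hlift, hle, by simp,
    isIsomorphic_theta_banana hxy hcard⟩

theorem EdgeSeparable.of_isImmersion {γ : Type u'} {δ : Type v'} {H : Graph γ δ}
    (hG : EdgeSeparable G k) (h : IsImmersion H G) : EdgeSeparable H k := by
  obtain ⟨G₀, G₁, G₂, hle, hlift, hle', -, hiso⟩ := h
  refine EdgeSeparable.of_isIsomorphic (EdgeSeparable.mono ?_ hle') hiso
  clear hle' hiso
  induction hlift with
  | refl => exact hG.mono hle
  | tail _ hstep ih => exact ih.of_isLifting hstep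

theorem not_isImmersion_theta_iff (hE : E(G).Finite) :
    ¬IsImmersion (theta (k + 1)) G ↔ EdgeSeparable G k := by
  refine ⟨fun h x hx y hy hxy hreach => h (hreach.isImmersion_theta hE hx hy hxy), fun hG h => ?_⟩
  exact hG.of_isImmersion h 0 (by simp [theta]) 1 (by simp [theta]) zero_ne_one
    (isEdgeReachable_theta (k + 1))

end Immersion

section FiniteLoopless

variable {α : Type u} {β : Type v} {G H : Graph α β} {a b x : α} {e : β} {k : ℕ}

theorem isLink_ne (hG : G.IsFiniteLoopless) (h : G.IsLink e a b) : a ≠ b :=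
  have := hG.loopless
  h.ne

theorem isFiniteLoopless_of_forall_ne (hV : V(G).Finite) (hE : E(G).Finite)
    (h : ∀ e a b, G.IsLink e a b → a ≠ b) : G.IsFiniteLoopless :=
  ⟨hV, hE, ⟨fun e a ha => h e a a ha rfl⟩⟩

theorem isFiniteLoopless_of_le (hG : G.IsFiniteLoopless) (h : H ≤ G) : H.IsFiniteLoopless :=
  isFiniteLoopless_of_forall_ne (hG.finite_vertexSet.subset h.vertexSet_mono)
    (hG.finite_edgeSet.subset h.edgeSet_mono) fun _ _ _ hl => isLink_ne hG (hl.mono h)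

theorem isFiniteLoopless_of_isIsomorphic {γ : Type u'} {δ : Type v'} {H : Graph γ δ}
    (h : IsIsomorphic G H) (hH : H.IsFiniteLoopless) : G.IsFiniteLoopless := by
  obtain ⟨φ, ψ, hφψ⟩ := h
  have := hH.finite_vertexSet.to_subtype
  have := hH.finite_edgeSet.to_subtype
  have : Finite V(G) := .of_equiv _ φ.symm
  have : Finite E(G) := .of_equiv _ ψ.symm
  refine isFiniteLoopless_of_forall_ne (Set.toFinite _) (Set.toFinite _) ?_
  rintro e a _ h rfl
  exact isLink_ne hH ((hφψ ⟨e, h.edge_mem⟩ ⟨a, h.left_mem⟩ ⟨a, h.left_mem⟩).1 h) rfl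

theorem cast_edgeDegree (hE : E(G).Finite) (x : α) :
    (G.edgeDegree x : ℕ∞) = (G.incidenceSet x).encard :=
  (hE.subset (G.incidenceSet_subset_edgeSet x)).cast_ncard_eq

theorem encard_edgeCut_singleton_le (hE : E(G).Finite) (hx : G.edgeDegree x ≤ k) :
    (edgeCut G {x}).encard ≤ k := by
  have hsub : edgeCut G {x} ⊆ G.incidenceSet x := by
    rintro e ⟨a, b, hab, rfl, -⟩
    exact hab.inc_left
  calc (edgeCut G {x}).encard ≤ (G.incidenceSet x).encard := Set.encard_le_encard hsub
    _ = G.edgeDegree x := (cast_edgeDegree hE x).symm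
    _ ≤ k := mod_cast hx

theorem edgeSeparable_of_almostBounded (h : AlmostBounded k α β G) : EdgeSeparable G k := by
  intro x hx y hy hxy
  by_cases hxk : G.edgeDegree x ≤ k
  · exact not_isEdgeReachable_of_encard_edgeCut_le (S := {x}) (by simpa using hxy.symm)
      (encard_edgeCut_singleton_le h.1.finite_edgeSet hxk)
  by_cases hyk : G.edgeDegree y ≤ k
  · exact not_isEdgeReachable_of_encard_edgeCut_le (S := {y}) (by simpa using hxy)
      (encard_edgeCut_singleton_le h.1.finite_edgeSet hyk)
  · exact absurd (h.2 ⟨hx, hxk⟩ ⟨hy, hyk⟩) hxy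

end FiniteLoopless

section DisjointUnion

variable {α₁ α₂ : Type u} {β₁ β₂ : Type v} {G₁ : Graph α₁ β₁} {G₂ : Graph α₂ β₂} {k m : ℕ}

theorem isFiniteLoopless_disjointUnion (h₁ : G₁.IsFiniteLoopless) (h₂ : G₂.IsFiniteLoopless) :
    (disjointUnion G₁ G₂).IsFiniteLoopless := by
  refine isFiniteLoopless_of_forall_ne
    ((h₁.finite_vertexSet.image _).union (h₂.finite_vertexSet.image _))
    (((h₁.finite_edgeSet.image .inl).union (h₂.finite_edgeSet.image .inr)).subset ?_) ?_
  · rintro _ ⟨_, _, h | h⟩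
    exacts [Or.inl ⟨_, h.edge_mem, rfl⟩, Or.inr ⟨_, h.edge_mem, rfl⟩]
  · rintro _ _ _ (h | h)
    exacts [Sum.inl_injective.ne (isLink_ne h₁ h), Sum.inr_injective.ne (isLink_ne h₂ h)]

theorem IsEdgeReachable.of_disjointUnion_inl {x y : α₁}
    (h : IsEdgeReachable (disjointUnion G₁ G₂) m (.inl x) (.inl y)) :
    IsEdgeReachable G₁ m x y := by
  refine h.map (Sum.elim id fun _ => x) (fun d => .inl d) ?_
  rintro _ _ _ (h | h) hne
  exacts [⟨⟨_, h.edge_mem⟩, rfl, h⟩, absurd rfl hne]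

theorem IsEdgeReachable.of_disjointUnion_inr {x y : α₂}
    (h : IsEdgeReachable (disjointUnion G₁ G₂) m (.inr x) (.inr y)) :
    IsEdgeReachable G₂ m x y := by
  refine h.map (Sum.elim (fun _ => x) id) (fun d => .inr d) ?_
  rintro _ _ _ (h | h) hne
  exacts [absurd rfl hne, ⟨⟨_, h.edge_mem⟩, rfl, h⟩]

theorem edgeCut_disjointUnion_range_inl (G₁ : Graph α₁ β₁) (G₂ : Graph α₂ β₂) :
    edgeCut (disjointUnion G₁ G₂) (Set.range Sum.inl) = ∅ := by
  rw [Set.eq_empty_iff_forall_notMem]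
  rintro _ ⟨_, _, h | h, ha, hb⟩
  exacts [hb ⟨_, rfl⟩, Sum.inl_ne_inr ha.choose_spec]

theorem edgeSeparable_disjointUnion (s₁ : EdgeSeparable G₁ k) (s₂ : EdgeSeparable G₂ k) :
    EdgeSeparable (disjointUnion G₁ G₂) k := by
  have hcross : (edgeCut (disjointUnion G₁ G₂) (Set.range Sum.inl)).encard ≤ k := by
    simp [edgeCut_disjointUnion_range_inl]
  rintro _ (⟨x, hx, rfl⟩ | ⟨x, hx, rfl⟩) _ (⟨y, hy, rfl⟩ | ⟨y, hy, rfl⟩) hxy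
  · exact fun h => s₁ x hx y hy (ne_of_apply_ne _ hxy) h.of_disjointUnion_inl
  · exact not_isEdgeReachable_of_encard_edgeCut_le (by simp) hcross
  · exact not_isEdgeReachable_of_encard_edgeCut_le (by simp) hcross
  · exact fun h => s₂ x hx y hy (ne_of_apply_ne _ hxy) h.of_disjointUnion_inr

end DisjointUnion

section EdgeSum

variable {α₁ α₂ : Type u} {β₁ β₂ : Type v} {G₁ : Graph α₁ β₁} {G₂ : Graph α₂ β₂} {k m : ℕ}
  {v₁ : α₁} {v₂ : α₂} {σ : G₁.incidenceSet v₁ ≃ G₂.incidenceSet v₂}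

theorem isFiniteLoopless_edgeSum (h₁ : G₁.IsFiniteLoopless) (h₂ : G₂.IsFiniteLoopless) :
    (edgeSum G₁ G₂ v₁ v₂ σ).IsFiniteLoopless := by
  refine isFiniteLoopless_of_forall_ne
    ((h₁.finite_vertexSet.sdiff.image _).union (h₂.finite_vertexSet.sdiff.image _))
    (((h₁.finite_edgeSet.image .inl).union (h₂.finite_edgeSet.image .inr)).subset ?_) ?_
  · rintro _ ⟨_, _, ⟨h, -, -⟩ | ⟨h, -, -⟩ | ⟨h, -, -, -⟩ | ⟨h, -, -, -⟩⟩
    exacts [Or.inl ⟨_, h.edge_mem, rfl⟩, Or.inr ⟨_, h.edge_mem, rfl⟩,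
      Or.inl ⟨_, h.edge_mem, rfl⟩, Or.inl ⟨_, h.edge_mem, rfl⟩]
  · rintro _ _ _ (⟨h, -, -⟩ | ⟨h, -, -⟩ | ⟨-, -, -, -⟩ | ⟨-, -, -, -⟩)
    exacts [Sum.inl_injective.ne (isLink_ne h₁ h), Sum.inr_injective.ne (isLink_ne h₂ h),
      Sum.inl_ne_inr, Sum.inr_ne_inl]

/-- Contracting the part of `G₂` to `v₁` turns the edge sum back into a subgraph of `G₁`. -/
theorem IsEdgeReachable.of_edgeSum_inl {x y : α₁}
    (h : IsEdgeReachable (edgeSum G₁ G₂ v₁ v₂ σ) m (.inl x) (.inl y)) :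
    IsEdgeReachable G₁ m x y := by
  refine h.map (Sum.elim id fun _ => v₁) (fun d => .inl d) ?_
  rintro _ _ _ (⟨h, -, -⟩ | ⟨h, -, -⟩ | ⟨h, -, -, -⟩ | ⟨h, -, -, -⟩) hne
  exacts [⟨⟨_, h.edge_mem⟩, rfl, h⟩, absurd rfl hne, ⟨⟨_, h.edge_mem⟩, rfl, h.symm⟩,
    ⟨⟨_, h.edge_mem⟩, rfl, h⟩]

open Classical in
theorem IsEdgeReachable.of_edgeSum_inr {x y : α₂}
    (h : IsEdgeReachable (edgeSum G₁ G₂ v₁ v₂ σ) m (.inr x) (.inr y)) :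
    IsEdgeReachable G₂ m x y := by
  let label : β₂ → β₁ ⊕ β₂ := fun d =>
    if hd : d ∈ G₂.incidenceSet v₂ then .inl (σ.symm ⟨d, hd⟩) else .inr d
  have label_apply (d : G₁.incidenceSet v₁) : label (σ d) = .inl d := by
    simp only [label, (σ d).2, dite_true, Subtype.coe_eta, Equiv.symm_apply_apply]
  refine h.map (Sum.elim (fun _ => v₂) id) (fun d => label d) ?_
  rintro _ _ _ (⟨-, -, -⟩ | ⟨h, hx, hy⟩ | ⟨h₁, -, h, -⟩ | ⟨h₁, -, h, -⟩) hne
  · exact absurd rfl hne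
  · refine ⟨⟨_, h.edge_mem⟩, dif_neg fun hi => ?_, h⟩
    exact (Inc.eq_or_eq_of_isLink hi h).elim (fun h => hx h.symm) fun h => hy h.symm
  · exact ⟨⟨_, h.edge_mem⟩, label_apply _, h⟩
  · exact ⟨⟨_, h.edge_mem⟩, label_apply _, h.symm⟩

theorem encard_edgeCut_edgeSum_range_inl_le :
    (edgeCut (edgeSum G₁ G₂ v₁ v₂ σ) (Set.range Sum.inl)).encard ≤
      (G₁.incidenceSet v₁).encard := by
  have hsub : edgeCut (edgeSum G₁ G₂ v₁ v₂ σ) (Set.range Sum.inl) ⊆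
      Sum.inl '' G₁.incidenceSet v₁ := by
    rintro _ ⟨_, _, ⟨-, -, -⟩ | ⟨-, -, -⟩ | ⟨h, -, -, -⟩ | ⟨-, -, -, -⟩, ha, hb⟩
    exacts [absurd ⟨_, rfl⟩ hb, absurd ha (by simp), ⟨_, h.inc_left, rfl⟩, absurd ⟨_, rfl⟩ hb]
  exact (Set.encard_le_encard hsub).trans (Set.encard_image_le _ _)

theorem edgeSeparable_edgeSum (s₁ : EdgeSeparable G₁ k) (s₂ : EdgeSeparable G₂ k)
    (hk : (G₁.incidenceSet v₁).encard ≤ k) : EdgeSeparable (edgeSum G₁ G₂ v₁ v₂ σ) k := by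
  have hcross : (edgeCut (edgeSum G₁ G₂ v₁ v₂ σ) (Set.range Sum.inl)).encard ≤ k :=
    encard_edgeCut_edgeSum_range_inl_le.trans hk
  rintro _ (⟨x, hx, rfl⟩ | ⟨x, hx, rfl⟩) _ (⟨y, hy, rfl⟩ | ⟨y, hy, rfl⟩) hxy
  · exact fun h => s₁ x hx.1 y hy.1 (ne_of_apply_ne _ hxy) h.of_edgeSum_inl
  · exact not_isEdgeReachable_of_encard_edgeCut_le (by simp) hcross
  · exact not_isEdgeReachable_of_encard_edgeCut_le (by simp) hcross
  · exact fun h => s₂ x hx.1 y hy.1 (ne_of_apply_ne _ hxy) h.of_edgeSum_inr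

theorem isFiniteLoopless_and_edgeSeparable_of_sumClosure {α : Type u} {β : Type v} {G : Graph α β}
    (h : SumClosure (AlmostBounded k) k α β G) : G.IsFiniteLoopless ∧ EdgeSeparable G k := by
  induction h with
  | base G h => exact ⟨h.1, edgeSeparable_of_almostBounded h⟩
  | sum G₁ G₂ G _ _ hsum _ _ ih₁ ih₂ =>
    obtain ⟨⟨f₁, s₁⟩, f₂, s₂⟩ := And.intro ih₁ ih₂
    rcases hsum with hiso | ⟨k', -, hk, v₁, -, v₂, -, hdeg, -, σ, hiso⟩
    · exact ⟨isFiniteLoopless_of_isIsomorphic hiso (isFiniteLoopless_disjointUnion f₁ f₂),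
        (edgeSeparable_disjointUnion s₁ s₂).of_isIsomorphic hiso⟩
    · have hk₁ : (G₁.incidenceSet v₁).encard ≤ k := by
        rw [← cast_edgeDegree f₁.finite_edgeSet, hdeg]
        exact mod_cast hk
      exact ⟨isFiniteLoopless_of_isIsomorphic hiso (isFiniteLoopless_edgeSum f₁ f₂),
        (edgeSeparable_edgeSum s₁ s₂ hk₁).of_isIsomorphic hiso⟩

end EdgeSum

section SplitSum

variable {γ : Type*} {s : Set γ} {c : γ}

open Classical in
/-- The injection into `γ ⊕ γ` that sends the elements of `s` to the left and all others to the
right. It relabels the vertices and the edges of a graph that is cut in two. -/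
noncomputable def splitSum (s : Set γ) : γ → γ ⊕ γ :=
  s.piecewise Sum.inl Sum.inr

theorem splitSum_of_mem (h : c ∈ s) : splitSum s c = .inl c :=
  if_pos h

theorem splitSum_of_notMem (h : c ∉ s) : splitSum s c = .inr c :=
  if_neg h

open Classical in
theorem splitSum_injective (s : Set γ) : Function.Injective (splitSum s) :=
  s.injective_piecewise_iff.2
    ⟨Sum.inl_injective.injOn, Sum.inr_injective.injOn, fun _ _ _ _ => Sum.inl_ne_inr⟩

theorem image_splitSum (s t : Set γ) :
    splitSum s '' t = Sum.inl '' (t ∩ s) ∪ Sum.inr '' (t \ s) := by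
  conv_lhs => rw [← Set.inter_union_sdiff t s, Set.image_union]
  congr 1
  exacts [Set.image_congr fun _ h => splitSum_of_mem h.2,
    Set.image_congr fun _ h => splitSum_of_notMem h.2]

end SplitSum

section DisjointUnionOfEmptyCut

variable {α : Type u} {β : Type v} {G : Graph α β} {X : Set α} {a b : α} {e : β}

theorem disjointUnion_deleteVerts_isLink (hX : edgeCut G X = ∅) (h : G.IsLink e a b) :
    (disjointUnion (G.deleteVerts Xᶜ) (G.deleteVerts X)).IsLink
      (splitSum (edgesMeeting G X) e) (splitSum X a) (splitSum X b) := by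
  have hiff : a ∈ X ↔ b ∈ X := by
    rw [← not_not (a := a ∈ X ↔ b ∈ X), ← mem_edgeCut_iff h, hX]
    exact Set.notMem_empty e
  by_cases ha : a ∈ X
  · have hb := hiff.1 ha
    rw [splitSum_of_mem ((mem_edgesMeeting_iff h).2 (Or.inl ha)), splitSum_of_mem ha,
      splitSum_of_mem hb]
    exact .left ((deleteVerts_isLink _ _).2 ⟨h, fun h => h ha, fun h => h hb⟩)
  · have hb := mt hiff.2 ha
    rw [splitSum_of_notMem (mt (mem_edgesMeeting_iff h).1 (not_or.2 ⟨ha, hb⟩)),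
      splitSum_of_notMem ha, splitSum_of_notMem hb]
    exact .right ((deleteVerts_isLink _ _).2 ⟨h, ha, hb⟩)

theorem isIsomorphic_disjointUnion_deleteVerts (hX : edgeCut G X = ∅) :
    IsIsomorphic G (disjointUnion (G.deleteVerts Xᶜ) (G.deleteVerts X)) := by
  refine isIsomorphic_of_injective (splitSum X) (splitSum (edgesMeeting G X))
    (splitSum_injective X) (splitSum_injective _) ?_ ?_
    fun e a b h => disjointUnion_deleteVerts_isLink hX h
  · rw [image_splitSum, ← Set.sdiff_compl, ← vertexSet_deleteVerts, ← vertexSet_deleteVerts]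
    rfl
  · rw [image_splitSum]
    rintro _ ⟨_, _, h | h⟩
    all_goals obtain ⟨h, ha, hb⟩ := (deleteVerts_isLink _ _).1 h
    · exact Or.inl ⟨_, ⟨h.edge_mem, (mem_edgesMeeting_iff h).2 (Or.inl (not_not.1 ha))⟩, rfl⟩
    · exact Or.inr ⟨_, ⟨h.edge_mem, mt (mem_edgesMeeting_iff h).1 (not_or.2 ⟨ha, hb⟩)⟩, rfl⟩

end DisjointUnionOfEmptyCut

section Collapse

variable {α : Type u} {β : Type v} {G : Graph α β} {X S : Set α} {u v a b : α} {e : β} {k : ℕ}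

open Classical in
/-- The graph obtained from `G` by identifying all vertices outside `X` with `v`. The edges with no
end in `X`, which would become loops, are deleted. -/
noncomputable def collapse (G : Graph α β) (X : Set α) (v : α) : Graph α β :=
  (G.restrict (edgesMeeting G X)).map (X.piecewise id fun _ => v)

theorem collapse_isLink_iff (ha : a ≠ v) (hb : b ≠ v) :
    (collapse G X v).IsLink e a b ↔ G.IsLink e a b ∧ a ∈ X ∧ b ∈ X := by
  constructor
  · rintro ⟨a, b, ⟨-, h⟩, rfl, rfl⟩
    have haX : a ∈ X := by_contra fun haX => ha (if_neg haX)
    have hbX : b ∈ X := by_contra fun hbX => hb (if_neg hbX)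
    simp [h, haX, hbX]
  · rintro ⟨h, haX, hbX⟩
    exact ⟨a, b, ⟨(mem_edgesMeeting_iff h).2 (Or.inl haX), h⟩, if_pos haX, if_pos hbX⟩

theorem collapse_isLink_of_notMem (h : G.IsLink e a b) (ha : a ∈ X) (hb : b ∉ X) :
    (collapse G X v).IsLink e v a :=
  ⟨b, a, ⟨(mem_edgesMeeting_iff h).2 (Or.inl ha), h.symm⟩, if_neg hb, if_pos ha⟩

theorem edgeSet_collapse (G : Graph α β) (X : Set α) (v : α) :
    E(collapse G X v) = edgesMeeting G X :=
  Set.inter_eq_right.2 (edgesMeeting_subset_edgeSet G X)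

theorem vertexSet_collapse (hvV : v ∈ V(G)) (hv : v ∉ X) :
    V(collapse G X v) = insert v (V(G) ∩ X) := by
  ext w
  constructor
  · rintro ⟨a, ha, rfl⟩
    by_cases haX : a ∈ X
    · exact Or.inr (by simp [haX, show a ∈ V(G) from ha])
    · exact Or.inl (if_neg haX)
  · rintro (rfl | ⟨hw, hwX⟩)
    exacts [⟨w, hvV, if_neg hv⟩, ⟨w, hw, if_pos hwX⟩]

theorem isFiniteLoopless_collapse (hG : G.IsFiniteLoopless) (hv : v ∉ X) :
    (collapse G X v).IsFiniteLoopless := by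
  refine isFiniteLoopless_of_forall_ne (hG.finite_vertexSet.image _)
    (hG.finite_edgeSet.subset Set.inter_subset_left) ?_
  rintro e _ _ ⟨a, b, ⟨he, h⟩, rfl, rfl⟩
  have hab := isLink_ne hG h
  rw [mem_edgesMeeting_iff h] at he
  by_cases ha : a ∈ X <;> by_cases hb : b ∈ X
  · simpa [ha, hb] using hab
  · simpa [ha, hb] using ne_of_mem_of_not_mem ha hv
  · simpa [ha, hb] using (ne_of_mem_of_not_mem hb hv).symm
  · exact absurd he (by tauto)

theorem edgeCut_collapse_subset (hv : v ∉ X) (hS : S ⊆ X) :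
    edgeCut (collapse G X v) S ⊆ edgeCut G S := by
  classical
  have hmem : ∀ c, X.piecewise id (fun _ => v) c ∈ S ↔ c ∈ S := by
    intro c
    by_cases hc : c ∈ X
    · simp [hc]
    · simp [hc, mt (@hS c) hc, mt (@hS v) hv]
  rintro e ⟨_, _, ⟨a, b, ⟨-, h⟩, rfl, rfl⟩, ha, hb⟩
  exact ⟨a, b, h, (hmem a).1 ha, mt (hmem b).2 hb⟩

theorem incidenceSet_collapse (hv : v ∉ X) :
    (collapse G X v).incidenceSet v = edgeCut G X := by
  ext e
  constructor
  · rintro ⟨_, a, b, ⟨he, h⟩, ha, rfl⟩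
    have haX : a ∉ X := fun haX => hv <| by
      have hav : a = v := (if_pos haX).symm.trans ha
      rwa [← hav]
    exact ⟨b, a, h.symm, ((mem_edgesMeeting_iff h).1 he).resolve_left haX, haX⟩
  · rintro ⟨a, b, h, ha, hb⟩
    exact (collapse_isLink_of_notMem h ha hb).inc_left

theorem ncard_vertexSet_collapse_lt (hG : G.IsFiniteLoopless) (hvV : v ∈ V(G)) (hv : v ∉ X)
    (hlt : (edgeCut G X).encard < G.edgeDegree v) :
    V(collapse G X v).ncard < V(G).ncard := by
  rw [vertexSet_collapse hvV hv]
  refine Set.ncard_lt_ncard ⟨Set.insert_subset hvV Set.inter_subset_left, fun hsub => ?_⟩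
    hG.finite_vertexSet
  rw [cast_edgeDegree hG.finite_edgeSet] at hlt
  refine hlt.not_ge (Set.encard_le_encard ?_)
  rintro e ⟨w, hw⟩
  have hwX : w ∈ X := ((hsub hw.right_mem).resolve_left (isLink_ne hG hw).symm).2
  exact ⟨w, v, hw.symm, hwX, hv⟩

/-- Two vertices of `X` are separated by the intersection of `X` with a cut of `G` avoiding `v`,
which is no larger because `X` is a minimum cut. -/
theorem EdgeSeparable.collapse (hs : EdgeSeparable G k) (hX : IsMinCut G u v X)
    (hvV : v ∈ V(G)) (hk : (edgeCut G X).encard ≤ k) : EdgeSeparable (collapse G X v) k := by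
  have hle : ∀ S ⊆ X, (edgeCut G S).encard ≤ k →
      (edgeCut (ThetaImmersion.collapse G X v) S).encard ≤ k := fun S hS h =>
    (Set.encard_le_encard (edgeCut_collapse_subset hX.notMem hS)).trans h
  have hXk := hle X subset_rfl hk
  have hvX := hX.notMem
  rw [EdgeSeparable, vertexSet_collapse hvV hvX]
  rintro x (rfl | ⟨hx, hxX⟩) y (rfl | ⟨hy, hyX⟩) hxy
  · exact absurd rfl hxy
  · exact not_isEdgeReachable_of_encard_edgeCut_le (by tauto) hXk
  · exact not_isEdgeReachable_of_encard_edgeCut_le (by tauto) hXk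
  · obtain ⟨S, hvS, hS, hSk⟩ := hs.exists_encard_edgeCut_le hx hy hxy v
    refine not_isEdgeReachable_of_encard_edgeCut_le (S := X ∩ S) (by simpa [hxX, hyX] using hS)
      (hle _ Set.inter_subset_left ((hX.encard_edgeCut_inter_le ?_ hvS).trans hSk))
    exact Set.finite_of_encard_le_coe hk

theorem edgeSum_collapse_isLink (hu : u ∈ X) (hv : v ∉ X)
    {σ : (collapse G X v).incidenceSet v ≃ (collapse G Xᶜ u).incidenceSet u}
    (hσ : ∀ e, (σ e : β) = e) (h : G.IsLink e a b) :
    (edgeSum (collapse G X v) (collapse G Xᶜ u) v u σ).IsLink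
      (splitSum (edgesMeeting G X) e) (splitSum X a) (splitSum X b) := by
  have hcross : ∀ {a b}, G.IsLink e a b → a ∈ X → b ∉ X →
      (edgeSum (collapse G X v) (collapse G Xᶜ u) v u σ).IsLink
        (splitSum (edgesMeeting G X) e) (splitSum X a) (splitSum X b) := by
    intro a b h ha hb
    rw [splitSum_of_mem ((mem_edgesMeeting_iff h).2 (Or.inl ha)), splitSum_of_mem ha,
      splitSum_of_notMem hb]
    refine .cross (collapse_isLink_of_notMem h ha hb) (ne_of_mem_of_not_mem ha hv) ?_
      (ne_of_mem_of_not_mem hu hb).symm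
    rw [hσ]
    exact collapse_isLink_of_notMem h.symm hb fun hb => hb ha
  by_cases ha : a ∈ X <;> by_cases hb : b ∈ X
  · have hav := ne_of_mem_of_not_mem ha hv
    have hbv := ne_of_mem_of_not_mem hb hv
    rw [splitSum_of_mem ((mem_edgesMeeting_iff h).2 (Or.inl ha)), splitSum_of_mem ha,
      splitSum_of_mem hb]
    exact .left ((collapse_isLink_iff hav hbv).2 ⟨h, ha, hb⟩) hav hbv
  · exact hcross h ha hb
  · exact (hcross h.symm hb ha).symm
  · have hau := (ne_of_mem_of_not_mem hu ha).symm
    have hbu := (ne_of_mem_of_not_mem hu hb).symm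
    rw [splitSum_of_notMem (mt (mem_edgesMeeting_iff h).1 (not_or.2 ⟨ha, hb⟩)),
      splitSum_of_notMem ha, splitSum_of_notMem hb]
    exact .right ((collapse_isLink_iff hau hbu).2 ⟨h, ha, hb⟩) hau hbu

theorem edgeSet_edgeSum_collapse_subset
    {σ : (collapse G X v).incidenceSet v ≃ (collapse G Xᶜ u).incidenceSet u} :
    E(edgeSum (collapse G X v) (collapse G Xᶜ u) v u σ) ⊆
      splitSum (edgesMeeting G X) '' E(G) := by
  have hinl : ∀ {e}, e ∈ E(collapse G X v) →
      Sum.inl e ∈ splitSum (edgesMeeting G X) '' E(G) := by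
    intro e he
    rw [edgeSet_collapse] at he
    exact ⟨e, edgesMeeting_subset_edgeSet G X he, splitSum_of_mem he⟩
  rintro _ ⟨_, _, ⟨h, -, -⟩ | ⟨h, hx, hy⟩ | ⟨h, -, -, -⟩ | ⟨h, -, -, -⟩⟩
  · exact hinl h.edge_mem
  · obtain ⟨h, hxX, hyX⟩ := (collapse_isLink_iff hx hy).1 h
    exact ⟨_, h.edge_mem, splitSum_of_notMem (mt (mem_edgesMeeting_iff h).1 (not_or.2 ⟨hxX, hyX⟩))⟩
  · exact hinl h.edge_mem
  · exact hinl h.edge_mem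

theorem isIsomorphic_edgeSum_collapse (huV : u ∈ V(G)) (hvV : v ∈ V(G)) (hu : u ∈ X) (hv : v ∉ X)
    {σ : (collapse G X v).incidenceSet v ≃ (collapse G Xᶜ u).incidenceSet u}
    (hσ : ∀ e, (σ e : β) = e) :
    IsIsomorphic G (edgeSum (collapse G X v) (collapse G Xᶜ u) v u σ) := by
  refine isIsomorphic_of_injective (splitSum X) (splitSum (edgesMeeting G X))
    (splitSum_injective X) (splitSum_injective _) ?_ edgeSet_edgeSum_collapse_subset
    fun e a b h => edgeSum_collapse_isLink hu hv hσ h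
  have hu' : u ∉ Xᶜ := fun h => h hu
  change Sum.inl '' (V(collapse G X v) \ {v}) ∪ Sum.inr '' (V(collapse G Xᶜ u) \ {u}) = _
  rw [vertexSet_collapse hvV hv, vertexSet_collapse huV hu', image_splitSum,
    Set.insert_sdiff_self_of_notMem fun h => hv h.2,
    Set.insert_sdiff_self_of_notMem fun h => hu' h.2, Set.sdiff_eq_compl_inter, Set.inter_comm Xᶜ]

end Collapse

section SumClosure

variable {α : Type u} {β : Type v} {G : Graph α β} {X : Set α} {u v : α} {k : ℕ}

theorem isEdgeSumLE_collapse (hG : G.IsFiniteLoopless) (huV : u ∈ V(G)) (hvV : v ∈ V(G))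
    (hu : u ∈ X) (hv : v ∉ X) (hne : (edgeCut G X).Nonempty) (hk : (edgeCut G X).encard ≤ k) :
    IsEdgeSumLE k (collapse G X v) (collapse G Xᶜ u) G := by
  have hu' : u ∉ Xᶜ := fun h => h hu
  have hinc₁ : (collapse G X v).incidenceSet v = edgeCut G X := incidenceSet_collapse hv
  have hinc₂ : (collapse G Xᶜ u).incidenceSet u = edgeCut G X := by
    rw [incidenceSet_collapse hu', edgeCut_compl]
  have hfin : (edgeCut G X).Finite := hG.finite_edgeSet.subset (edgeCut_subset_edgeSet G X)
  refine Or.inr ⟨(edgeCut G X).ncard, (Set.ncard_pos hfin).2 hne, ?_, v, ?_, u, ?_,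
    congrArg Set.ncard hinc₁, congrArg Set.ncard hinc₂, Equiv.setCongr (hinc₁.trans hinc₂.symm),
    isIsomorphic_edgeSum_collapse huV hvV hu hv fun _ => rfl⟩
  · rw [← hfin.cast_ncard_eq] at hk
    exact mod_cast hk
  · exact vertexSet_collapse hvV hv ▸ Set.mem_insert v _
  · exact vertexSet_collapse huV hu' ▸ Set.mem_insert u _

theorem ncard_vertexSet_deleteVerts_lt (hV : V(G).Finite) (hvV : v ∈ V(G)) (hv : v ∈ X) :
    V(G.deleteVerts X).ncard < V(G).ncard := by
  rw [vertexSet_deleteVerts]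
  exact Set.ncard_lt_ncard ⟨Set.sdiff_subset, fun h => (h hvV).2 hv⟩ hV

theorem EdgeSeparable.sumClosure (hs : EdgeSeparable G k) (hG : G.IsFiniteLoopless) :
    SumClosure (AlmostBounded k) k α β G := by
  induction hn : V(G).ncard using Nat.strong_induction_on generalizing G with
  | _ n ih =>
  subst hn
  by_cases hA : {x ∈ V(G) | ¬G.edgeDegree x ≤ k}.Subsingleton
  · exact .base G ⟨hG, hA⟩
  obtain ⟨u, ⟨huV, hu⟩, v, ⟨hvV, hv⟩, huv⟩ := Set.not_subsingleton_iff.1 hA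
  obtain ⟨X, hX⟩ := exists_isMinCut G huv
  have hX' := hX.compl
  have hk : (edgeCut G X).encard ≤ k := by
    obtain ⟨S, huS, hvS, hSk⟩ := not_isEdgeReachable_add_one_iff.1 (hs u huV v hvV huv)
    exact (hX.le S huS hvS).trans hSk
  have hk' : (edgeCut G Xᶜ).encard ≤ k := by rwa [edgeCut_compl]
  rcases (edgeCut G X).eq_empty_or_nonempty with hempty | hne
  · have hlt₁ := ncard_vertexSet_deleteVerts_lt hG.finite_vertexSet hvV hX'.mem
    have hlt₂ := ncard_vertexSet_deleteVerts_lt hG.finite_vertexSet huV hX.mem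
    exact .sum _ _ G
      (ih _ hlt₁ (hs.mono deleteVerts_le) (isFiniteLoopless_of_le hG deleteVerts_le) rfl)
      (ih _ hlt₂ (hs.mono deleteVerts_le) (isFiniteLoopless_of_le hG deleteVerts_le) rfl)
      (Or.inl (isIsomorphic_disjointUnion_deleteVerts hempty)) hlt₁ hlt₂
  · have hlt₁ := ncard_vertexSet_collapse_lt hG hvV hX.notMem
      (hk.trans_lt (mod_cast not_le.1 hv))
    have hlt₂ := ncard_vertexSet_collapse_lt hG huV hX'.notMem
      (hk'.trans_lt (mod_cast not_le.1 hu))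
    exact .sum _ _ G
      (ih _ hlt₁ (hs.collapse hX hvV hk) (isFiniteLoopless_collapse hG hX.notMem) rfl)
      (ih _ hlt₂ (hs.collapse hX' huV hk') (isFiniteLoopless_collapse hG hX'.notMem) rfl)
      (isEdgeSumLE_collapse hG huV hvV hX.mem hX.notMem hne hk) hlt₁ hlt₂

end SumClosure

end ThetaImmersion

theorem mainTheorem2 {α : Type u} {β : Type v} (G : Graph α β) (hG : G.IsFiniteLoopless) (k : ℕ) :
    ¬ Graph.IsImmersion (Graph.theta (k + 1)) G ↔
      Graph.SumClosure (Graph.AlmostBounded k) k α β G := by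
  rw [ThetaImmersion.not_isImmersion_theta_iff hG.finite_edgeSet]
  exact ⟨fun h => h.sumClosure hG,
    fun h => (ThetaImmersion.isFiniteLoopless_and_edgeSeparable_of_sumClosure h).2⟩
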